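/- Let $d \ge 2$ be an even integer. For a finite simple graph $G$ of order $n$ with adjacency eigenvalues $\lambda_1, \dots, \lambda_n$ (listed with multiplicity), define the CHS $d$-norm of $G$ by $\|G\|_d = \big(h_d(\lambda_1, \dots, \lambda_n)\big)^{1/d}$, where $h_d(x_1, \dots, x_n) = \sum_{1 \le i_1 \le i_2 \le \cdots \le i_d \le n} x_{i_1} x_{i_2} \cdots x_{i_d}$ is the complete homogeneous symmetric polynomial of degree $d$. Let $P_n$, $K_n$ and $S_n$ denote the path, the complete graph and the star (one central vertex joined to $n-1$ leaves) of order $n$. Then: (a) If $G$ is a simple connected graph of order $n$, then $\|P_n\|_d \le \|G\|_d \le \|K_n\|_d$. (b) If $T$ is a tree of order $n$, then $\|P_n\|_d \le \|T\|_d \le \|S_n\|_d$. -/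

import Mathlib

noncomputable section

/-- The complete homogeneous symmetric polynomial `h_d` evaluated at a real vector `x`. -/
def chsEval {ι : Type*} [Fintype ι] [DecidableEq ι] (d : ℕ) (x : ι → ℝ) : ℝ :=
  MvPolynomial.eval x (MvPolynomial.hsymm ι ℝ d)

/-- The CHS `d`-norm of a Hermitian matrix: `h_d(λ₁, …, λₙ) ^ (1 / d)`, where `λ₁, …, λₙ` are
the eigenvalues listed with multiplicity. -/
def Matrix.IsHermitian.chsNorm {𝕜 : Type*} [RCLike 𝕜] {ι : Type*} [Fintype ι] [DecidableEq ι]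
    {A : Matrix ι ι 𝕜} (hA : A.IsHermitian) (d : ℕ) : ℝ :=
  chsEval d hA.eigenvalues ^ (1 / (d : ℝ))

open Classical in
/-- The CHS `d`-norm of a finite simple graph: the CHS `d`-norm of its adjacency matrix. -/
def SimpleGraph.chsNorm {V : Type*} [Fintype V] (G : SimpleGraph V) (d : ℕ) : ℝ :=
  (show (G.adjMatrix ℝ).IsHermitian from G.isHermitian_adjMatrix ℝ).chsNorm d

/-- The path `P_n`: vertices `0, …, n - 1`, consecutive ones being adjacent. -/
def pathOfOrder (n : ℕ) : SimpleGraph (Fin n) := SimpleGraph.pathGraph n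

/-- The complete graph `K_n`. -/
def completeOfOrder (n : ℕ) : SimpleGraph (Fin n) := SimpleGraph.completeGraph (Fin n)

/-- The star `S_n` of order `n`: the vertex `0` is adjacent to each of the other `n - 1`
vertices, and there are no further edges. -/
def starOfOrder (n : ℕ) : SimpleGraph (Fin n) where
  Adj i j := i ≠ j ∧ ((i : ℕ) = 0 ∨ (j : ℕ) = 0)
  symm := ⟨fun _ _ h => ⟨h.1.symm, h.2.symm⟩⟩
  loopless := ⟨fun _ h => h.1 rfl⟩

end

/-! The numbers $h_d(\lambda)$ are the coefficients of $F = 1/\det(1 - XA)$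
(`Matrix.IsHermitian.coeff_detSeries`), so it suffices to compare these series coefficientwise;
taking $d$-th roots is monotone.

Peeling off vertices writes $F$ as a product of closed-walk series, which grow when edges are added.
Hence a connected graph lies between any of its spanning trees and the complete graph, and only
trees remain.

Cutting a tree at an edge $uw$, with walk series $W_1, W_2$ at the ends and series $F_1, F_2$ of the
two halves, gives $F = F_1 F_2 / (1 - X^2 W_1 W_2)$ and $W_u = W_1 / (1 - X^2 W_1 W_2)$. Both are
monotone in the data of the halves, so induction replaces the halves by paths or stars. Two paths
joined at ends form a path, whose closed walks are fewest at an end (`pathWalk_add_le`); two stars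
joined at centers lie below a star (`starSeries_add`). The induction is
`SimpleGraph.IsTree.series_bounds`. -/

namespace PowerSeries

/-- The coefficientwise order on real power series. -/
def CoeffLE (f g : ℝ⟦X⟧) : Prop := ∀ n, coeff n f ≤ coeff n g

/-! ### Coefficientwise inequalities of power series -/

namespace CoeffLE

variable {f g h k : ℝ⟦X⟧}

theorem refl (f : ℝ⟦X⟧) : CoeffLE f f := fun _ => le_rfl

theorem trans (h₁ : CoeffLE f g) (h₂ : CoeffLE g h) : CoeffLE f h :=
  fun n => (h₁ n).trans (h₂ n)

theorem sub_nonneg_iff : CoeffLE 0 (g - f) ↔ CoeffLE f g := by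
  simp [CoeffLE]

theorem mul_nonneg (hf : CoeffLE 0 f) (hg : CoeffLE 0 g) : CoeffLE 0 (f * g) := by
  intro n
  rw [coeff_mul, map_zero]
  exact Finset.sum_nonneg fun p _ => _root_.mul_nonneg (hf p.1) (hg p.2)

theorem add_nonneg (hf : CoeffLE 0 f) (hg : CoeffLE 0 g) : CoeffLE 0 (f + g) := by
  intro n
  simpa using _root_.add_nonneg (hf n) (hg n)

theorem mul_mono (hf : CoeffLE 0 f) (hfg : CoeffLE f g) (hh : CoeffLE 0 h) (hhk : CoeffLE h k) :
    CoeffLE (f * h) (g * k) := by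
  rw [← sub_nonneg_iff] at hfg hhk ⊢
  have hg : CoeffLE 0 g := by simpa using hfg.add_nonneg hf
  have : g * k - f * h = g * (k - h) + (g - f) * h := by ring
  rw [this]
  exact (hg.mul_nonneg hhk).add_nonneg (hfg.mul_nonneg hh)

theorem X_nonneg : CoeffLE 0 (X : ℝ⟦X⟧) := by
  intro n
  rw [coeff_X, map_zero]
  split_ifs <;> norm_num

theorem X_sq_nonneg : CoeffLE 0 (X ^ 2 : ℝ⟦X⟧) := by
  rw [sq]
  exact X_nonneg.mul_nonneg X_nonneg

theorem C_nonneg {a : ℝ} (ha : 0 ≤ a) : CoeffLE 0 (C a) := by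
  intro n
  rw [coeff_C, map_zero]
  split_ifs <;> simp [ha]

theorem one_le (hf : CoeffLE 0 f) (h0 : constantCoeff f = 1) : CoeffLE 1 f := by
  intro n
  rcases n with _ | n
  · simp [h0]
  · simpa [coeff_one] using hf (n + 1)

theorem one_sub_mul_inv (h0 : constantCoeff f = 0) : (1 - f) * (1 - f)⁻¹ = 1 :=
  PowerSeries.mul_inv_cancel _ (by simp [h0])

/-- Since `f` has no constant term, $(1-f)^{-1} = 1 + f(1-f)^{-1}$ expresses each coefficient
through earlier ones. -/
theorem one_sub_inv_nonneg (hf : CoeffLE 0 f) (h0 : constantCoeff f = 0) :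
    CoeffLE 0 (1 - f)⁻¹ := by
  have hrec : (1 - f)⁻¹ = 1 + f * (1 - f)⁻¹ := by
    linear_combination one_sub_mul_inv h0
  intro n
  induction n using Nat.strong_induction_on with
  | _ n ih =>
    rw [hrec, map_add, coeff_mul, map_zero]
    refine _root_.add_nonneg (by rw [coeff_one]; split_ifs <;> norm_num)
      (Finset.sum_nonneg fun p hp => ?_)
    rcases Nat.eq_zero_or_pos p.1 with h | h
    · simp [h, h0]
    · have := Finset.HasAntidiagonal.mem_antidiagonal.1 hp
      exact _root_.mul_nonneg (hf p.1) (ih p.2 (by omega))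

theorem one_sub_inv_mono (hf : CoeffLE 0 f) (hfg : CoeffLE f g) (hf0 : constantCoeff f = 0)
    (hg0 : constantCoeff g = 0) : CoeffLE (1 - f)⁻¹ (1 - g)⁻¹ := by
  have hg : CoeffLE 0 g := hf.trans hfg
  rw [← sub_nonneg_iff] at hfg ⊢
  have : (1 - g)⁻¹ - (1 - f)⁻¹ = (g - f) * ((1 - f)⁻¹ * (1 - g)⁻¹) := by
    linear_combination (-(1 - g)⁻¹) * one_sub_mul_inv hf0 + (1 - f)⁻¹ * one_sub_mul_inv hg0
  rw [this]
  exact hfg.mul_nonneg ((one_sub_inv_nonneg hf hf0).mul_nonneg (one_sub_inv_nonneg hg hg0))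

end CoeffLE

/-- The factor `(1 - X² f g)⁻¹` that arises when two rooted graphs with closed-walk series
`f` and `g` at their roots are joined by an edge between the roots. -/
noncomputable def edgeFactor (f g : ℝ⟦X⟧) : ℝ⟦X⟧ := (1 - X ^ 2 * (f * g))⁻¹

section edgeFactor

variable {f g f' g' : ℝ⟦X⟧}

theorem mul_edgeFactor (f g : ℝ⟦X⟧) : (1 - X ^ 2 * (f * g)) * edgeFactor f g = 1 :=
  CoeffLE.one_sub_mul_inv (by simp)

theorem edgeFactor_nonneg (hf : CoeffLE 0 f) (hg : CoeffLE 0 g) : CoeffLE 0 (edgeFactor f g) :=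
  CoeffLE.one_sub_inv_nonneg (CoeffLE.X_sq_nonneg.mul_nonneg (hf.mul_nonneg hg)) (by simp)

theorem edgeFactor_mono (hf : CoeffLE 0 f) (hff : CoeffLE f f') (hg : CoeffLE 0 g)
    (hgg : CoeffLE g g') : CoeffLE (edgeFactor f g) (edgeFactor f' g') :=
  CoeffLE.one_sub_inv_mono (CoeffLE.X_sq_nonneg.mul_nonneg (hf.mul_nonneg hg))
    (CoeffLE.X_sq_nonneg.mul_mono (.refl _) (hf.mul_nonneg hg) (hf.mul_mono hff hg hgg))
    (by simp) (by simp)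

end edgeFactor

/-! ### Determinant and walk series of paths -/

/-- The reversed characteristic polynomials of the paths, as power series; the index is shifted
by one, so that `pathDet (n + 1)` belongs to the path of order `n` and `pathDet 0 = 0`. -/
noncomputable def pathDet : ℕ → ℝ⟦X⟧
  | 0 => 0
  | 1 => 1
  | n + 2 => pathDet (n + 1) - X ^ 2 * pathDet n

/-- The series counting closed walks of the path of order `n` at one of its ends. -/
noncomputable def pathWalk : ℕ → ℝ⟦X⟧
  | 0 => 0
  | n + 1 => edgeFactor 1 (pathWalk n)

/-- The generating series of the numbers `h_d` of the path of order `n`. -/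
noncomputable def pathSeries : ℕ → ℝ⟦X⟧
  | 0 => 1
  | n + 1 => pathSeries n * pathWalk (n + 1)

/-- Cramer's rule at an end vertex, in division-free form. -/
theorem pathDet_mul_pathWalk (n : ℕ) : pathDet (n + 1) * pathWalk n = pathDet n := by
  induction n with
  | zero => simp [pathDet, pathWalk]
  | succ n ih =>
    have h := mul_edgeFactor 1 (pathWalk n)
    rw [pathWalk, pathDet]
    linear_combination pathDet (n + 1) * h + X ^ 2 * edgeFactor 1 (pathWalk n) * ih

theorem pathDet_mul_pathSeries (n : ℕ) : pathDet (n + 1) * pathSeries n = 1 := by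
  induction n with
  | zero => simp [pathDet, pathSeries]
  | succ n ih =>
    rw [pathSeries]
    linear_combination ih + pathSeries n * pathDet_mul_pathWalk (n + 1)

/-- Expansion along the joining edge: either the edge is removed, or both of its ends are. The value
`pathDet 0 = 0` covers an empty side. -/
theorem pathDet_add (a b : ℕ) :
    pathDet (a + b + 1) = pathDet (a + 1) * pathDet (b + 1) - X ^ 2 * (pathDet a * pathDet b) := by
  induction b using Nat.twoStepInduction with
  | zero => simp [pathDet]
  | one => simp [pathDet]
  | more b h₀ h₁ =>
    have e₁ : pathDet (a + (b + 2) + 1) =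
      pathDet (a + (b + 1) + 1) - X ^ 2 * pathDet (a + b + 1) := rfl
    have e₂ : pathDet (b + 2 + 1) = pathDet (b + 1 + 1) - X ^ 2 * pathDet (b + 1) := rfl
    have e₃ : pathDet (b + 2) = pathDet (b + 1) - X ^ 2 * pathDet b := rfl
    rw [e₁, e₂, h₀, h₁]
    linear_combination X ^ 2 * pathDet a * e₃

theorem pathWalk_nonneg (n : ℕ) : CoeffLE 0 (pathWalk n) := by
  induction n with
  | zero => exact .refl _
  | succ n ih => exact edgeFactor_nonneg (by simpa using CoeffLE.C_nonneg zero_le_one) ih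

theorem pathSeries_nonneg (n : ℕ) : CoeffLE 0 (pathSeries n) := by
  induction n with
  | zero => simpa [pathSeries] using CoeffLE.C_nonneg zero_le_one
  | succ n ih => exact ih.mul_nonneg (pathWalk_nonneg _)

/-- Joining two paths end to end yields a path. -/
theorem pathSeries_add (a b : ℕ) :
    pathSeries (a + b) = pathSeries a * pathSeries b * edgeFactor (pathWalk a) (pathWalk b) := by
  have key : pathDet (a + b + 1) =
      pathDet (a + 1) * pathDet (b + 1) * (1 - X ^ 2 * (pathWalk a * pathWalk b)) := by
    rw [pathDet_add, ← pathDet_mul_pathWalk a, ← pathDet_mul_pathWalk b]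
    ring
  have h : pathDet (a + b + 1) *
      (pathSeries a * pathSeries b * edgeFactor (pathWalk a) (pathWalk b)) = 1 := by
    rw [key]
    linear_combination (pathDet (b + 1) * pathSeries b) *
        ((1 - X ^ 2 * (pathWalk a * pathWalk b)) * edgeFactor (pathWalk a) (pathWalk b)) *
          pathDet_mul_pathSeries a +
      ((1 - X ^ 2 * (pathWalk a * pathWalk b)) * edgeFactor (pathWalk a) (pathWalk b)) *
        pathDet_mul_pathSeries b + mul_edgeFactor (pathWalk a) (pathWalk b)
  linear_combination (pathSeries a * pathSeries b * edgeFactor (pathWalk a) (pathWalk b)) *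
    pathDet_mul_pathSeries (a + b) - pathSeries (a + b) * h

/-- A path has at least as many closed walks at an inner vertex as at an end. -/
theorem pathWalk_add_le (a b : ℕ) :
    CoeffLE (pathWalk (a + 1 + b))
      (pathWalk (a + 1) * edgeFactor (pathWalk (a + 1)) (pathWalk b)) := by
  rw [← CoeffLE.sub_nonneg_iff]
  set g := edgeFactor (pathWalk (a + 1)) (pathWalk b) with hg
  have hS := pathSeries_add (a + 1) b
  have hD := pathDet_mul_pathSeries (a + 1 + b)
  have hW := pathDet_mul_pathWalk (a + 1 + b)
  have hWa := pathDet_mul_pathWalk (a + 1)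
  have hWa' := pathDet_mul_pathWalk a
  have hWb := pathDet_mul_pathWalk b
  have hSa := pathDet_mul_pathSeries (a + 1)
  have hSb := pathDet_mul_pathSeries b
  have hadd : pathDet (a + 1 + b) =
      pathDet (a + 1) * pathDet (b + 1) - X ^ 2 * (pathDet a * pathDet b) := by
    rw [← pathDet_add, add_right_comm]
  have e₁ : pathWalk (a + 1 + b) = pathDet (a + 1 + b) * pathSeries (a + 1 + b) := by
    linear_combination pathSeries (a + 1 + b) * hW - pathWalk (a + 1 + b) * hD
  have e₂ : pathWalk (a + 1) = pathDet (a + 1) * pathSeries (a + 1) := by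
    linear_combination pathSeries (a + 1) * hWa - pathWalk (a + 1) * hSa
  have e₃ : pathWalk b = pathDet b * pathSeries b := by
    linear_combination pathSeries b * hWb - pathWalk b * hSb
  -- Both terms contain `pathSeries (a + 1) * g`; in the other factor `pathDet (a + 1)` cancels, and
  -- only the `X ^ 2` term of `hadd` survives.
  have key : pathWalk (a + 1) * g - pathWalk (a + 1 + b) =
      X ^ 2 * ((pathWalk a * pathWalk (a + 1)) * (pathWalk b * g)) := by
    rw [e₁, hS, hadd, ← hg, e₂, e₃, ← hWa']
    linear_combination (-pathDet (a + 1) * pathSeries (a + 1) * g) * hSb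
  rw [key]
  exact CoeffLE.X_sq_nonneg.mul_nonneg
    (((pathWalk_nonneg _).mul_nonneg (pathWalk_nonneg _)).mul_nonneg
    ((pathWalk_nonneg _).mul_nonneg (edgeFactor_nonneg (pathWalk_nonneg _) (pathWalk_nonneg _))))

end PowerSeries

section GeneratingSeries

open PowerSeries

/-! ### The resolvent and the reciprocal determinant -/

namespace Matrix

section Resolvent

variable {ι κ : Type*} [Fintype ι] [DecidableEq ι] [Fintype κ] [DecidableEq κ]

/-- The matrix `1 - X A` over the power series ring. -/
noncomputable def oneSubX (A : Matrix ι ι ℝ) : Matrix ι ι ℝ⟦X⟧ :=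
  1 - (X : ℝ⟦X⟧) • A.map (C (R := ℝ))

/-- The power series `∑ Aᵏ Xᵏ`. -/
noncomputable def walkMatrix (A : Matrix ι ι ℝ) : Matrix ι ι ℝ⟦X⟧ :=
  of fun i j => mk fun k => (A ^ k) i j

/-- The power series `1 / det (1 - X A)`. -/
noncomputable def detSeries (A : Matrix ι ι ℝ) : ℝ⟦X⟧ := (oneSubX A).det⁻¹

theorem oneSubX_mul_walkMatrix (A : Matrix ι ι ℝ) : oneSubX A * walkMatrix A = 1 := by
  rw [oneSubX, Matrix.sub_mul, Matrix.one_mul, Matrix.smul_mul]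
  ext i j n
  rw [sub_apply, smul_apply, smul_eq_mul, map_sub]
  rcases n with _ | n
  · simp [walkMatrix, one_apply, apply_ite]
  · rw [coeff_succ_X_mul, mul_apply, map_sum]
    simp [walkMatrix, pow_succ', mul_apply, one_apply, apply_ite, coeff_one]

theorem constantCoeff_det_oneSubX (A : Matrix ι ι ℝ) : constantCoeff (oneSubX A).det = 1 := by
  rw [RingHom.map_det]
  convert det_one (R := ℝ) (n := ι)
  ext i j
  simp [oneSubX, one_apply, apply_ite]

theorem det_mul_detSeries (A : Matrix ι ι ℝ) : (oneSubX A).det * detSeries A = 1 :=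
  PowerSeries.mul_inv_cancel _ (by simp [constantCoeff_det_oneSubX])

theorem constantCoeff_detSeries (A : Matrix ι ι ℝ) : constantCoeff (detSeries A) = 1 := by
  simp [detSeries, constantCoeff_inv, constantCoeff_det_oneSubX]

theorem walkMatrix_mul_oneSubX (A : Matrix ι ι ℝ) : walkMatrix A * oneSubX A = 1 :=
  mul_eq_one_comm.1 (oneSubX_mul_walkMatrix A)

theorem eq_walkMatrix_mulVec {A : Matrix ι ι ℝ} {x y : ι → ℝ⟦X⟧} (h : oneSubX A *ᵥ x = y) :
    x = walkMatrix A *ᵥ y := by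
  rw [← h, mulVec_mulVec, walkMatrix_mul_oneSubX, one_mulVec]

theorem walkMatrix_eq_adjugate_mul (A : Matrix ι ι ℝ) :
    walkMatrix A = detSeries A • (oneSubX A).adjugate := by
  have h : (oneSubX A) * (detSeries A • (oneSubX A).adjugate) = 1 := by
    rw [Matrix.mul_smul, mul_adjugate, smul_smul, mul_comm, det_mul_detSeries, one_smul]
  calc walkMatrix A = walkMatrix A * ((oneSubX A) * (detSeries A • (oneSubX A).adjugate)) := by
        rw [h, Matrix.mul_one]
    _ = _ := by rw [← Matrix.mul_assoc, walkMatrix_mul_oneSubX, Matrix.one_mul]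

omit [Fintype ι] [Fintype κ] in
theorem oneSubX_submatrix_equiv (e : ι ≃ κ) (A : Matrix κ κ ℝ) :
    oneSubX (A.submatrix e e) = (oneSubX A).submatrix e e := by
  ext1 i j
  simp [oneSubX, one_apply]

theorem detSeries_submatrix_equiv (e : ι ≃ κ) (A : Matrix κ κ ℝ) :
    detSeries (A.submatrix e e) = detSeries A := by
  rw [detSeries, oneSubX_submatrix_equiv, det_submatrix_equiv_self, detSeries]

theorem walkMatrix_submatrix_equiv (e : ι ≃ κ) (A : Matrix κ κ ℝ) (i j : ι) :
    walkMatrix (A.submatrix e e) i j = walkMatrix A (e i) (e j) := by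
  have h (k : ℕ) : (A.submatrix e e) ^ k = (A ^ k).submatrix e e := by
    induction k with
    | zero => simp
    | succ k ih => rw [pow_succ, ih, pow_succ, submatrix_mul_equiv]
  simp [walkMatrix, h]

theorem pow_nonneg_apply {A : Matrix ι ι ℝ} (hA : ∀ i j, 0 ≤ A i j) (k : ℕ) (i j : ι) :
    0 ≤ (A ^ k) i j := by
  induction k generalizing i j with
  | zero => rw [pow_zero, one_apply]; split_ifs <;> norm_num
  | succ k ih =>
    rw [pow_succ, mul_apply]
    exact Finset.sum_nonneg fun l _ => mul_nonneg (ih _ _) (hA _ _)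

theorem pow_mono_apply {A B : Matrix ι ι ℝ} (hA : ∀ i j, 0 ≤ A i j) (hAB : ∀ i j, A i j ≤ B i j)
    (k : ℕ) (i j : ι) : (A ^ k) i j ≤ (B ^ k) i j := by
  induction k generalizing i j with
  | zero => simp
  | succ k ih =>
    rw [pow_succ, pow_succ, mul_apply, mul_apply]
    exact Finset.sum_le_sum fun l _ => mul_le_mul (ih _ _) (hAB _ _) (hA _ _)
      ((pow_nonneg_apply hA k i l).trans (ih i l))

theorem walkMatrix_nonneg {A : Matrix ι ι ℝ} (hA : ∀ i j, 0 ≤ A i j) (i j : ι) :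
    CoeffLE 0 (walkMatrix A i j) := fun k => by
  simpa [walkMatrix] using pow_nonneg_apply hA k i j

theorem walkMatrix_mono {A B : Matrix ι ι ℝ} (hA : ∀ i j, 0 ≤ A i j)
    (hAB : ∀ i j, A i j ≤ B i j) (i j : ι) : CoeffLE (walkMatrix A i j) (walkMatrix B i j) :=
  fun k => by simpa [walkMatrix] using pow_mono_apply hA hAB k i j

end Resolvent

section Monotone

/-- Removing the first index divides `1 / det (1 - X A)` by its closed-walk series. -/
theorem detSeries_succ {n : ℕ} (A : Matrix (Fin (n + 1)) (Fin (n + 1)) ℝ) :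
    detSeries A = walkMatrix A 0 0 * detSeries (A.submatrix Fin.succ Fin.succ) := by
  have h : (oneSubX A).adjugate 0 0 = (oneSubX (A.submatrix Fin.succ Fin.succ)).det := by
    rw [adjugate_fin_succ_eq_det_submatrix]
    simp only [Fin.val_zero, add_zero, pow_zero, one_mul]
    congr 1
    ext1 i j
    simp [oneSubX, one_apply]
  rw [walkMatrix_eq_adjugate_mul, smul_apply, h, smul_eq_mul, mul_assoc, det_mul_detSeries, mul_one]

/-- By `detSeries_succ`, the series is a product of closed-walk series of successively smaller
principal submatrices; each has nonnegative coefficients that increase with the entries. -/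
theorem detSeries_nonneg_mono_fin {n : ℕ} {A B : Matrix (Fin n) (Fin n) ℝ}
    (hA : ∀ i j, 0 ≤ A i j) (hAB : ∀ i j, A i j ≤ B i j) :
    CoeffLE 0 (detSeries A) ∧ CoeffLE (detSeries A) (detSeries B) := by
  induction n with
  | zero =>
    rw [Subsingleton.elim A B]
    refine ⟨?_, .refl _⟩
    simpa [detSeries] using CoeffLE.C_nonneg zero_le_one
  | succ n ih =>
    obtain ⟨h₁, h₂⟩ := ih (A := A.submatrix Fin.succ Fin.succ) (B := B.submatrix Fin.succ Fin.succ)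
      (fun _ _ => hA _ _) fun _ _ => hAB _ _
    rw [detSeries_succ A, detSeries_succ B]
    exact ⟨(walkMatrix_nonneg hA 0 0).mul_nonneg h₁,
      (walkMatrix_nonneg hA 0 0).mul_mono (walkMatrix_mono hA hAB 0 0) h₁ h₂⟩

variable {ι : Type*} [Fintype ι] [DecidableEq ι]

theorem detSeries_mono {A B : Matrix ι ι ℝ} (hA : ∀ i j, 0 ≤ A i j)
    (hAB : ∀ i j, A i j ≤ B i j) : CoeffLE (detSeries A) (detSeries B) := by
  let e := (Fintype.equivFin ι).symm
  rw [← detSeries_submatrix_equiv e A, ← detSeries_submatrix_equiv e B]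
  exact (detSeries_nonneg_mono_fin (fun _ _ => hA _ _) fun _ _ => hAB _ _).2

end Monotone

/-! ### Joining two graphs by an edge -/

section EdgeJoin

variable {ι κ : Type*} [Fintype ι] [DecidableEq ι] [Fintype κ] [DecidableEq κ]

/-- The adjacency matrix of the disjoint union of two graphs, joined by an edge `ij`. -/
def edgeJoin (A : Matrix ι ι ℝ) (B : Matrix κ κ ℝ) (i : ι) (j : κ) : Matrix (ι ⊕ κ) (ι ⊕ κ) ℝ :=
  fromBlocks A (single i j 1) (single j i 1) B

omit [Fintype ι] [Fintype κ] in
theorem oneSubX_edgeJoin (A : Matrix ι ι ℝ) (B : Matrix κ κ ℝ) (i : ι) (j : κ) :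
    oneSubX (edgeJoin A B i j) =
      fromBlocks (oneSubX A) (single i j (-X)) (single j i (-X)) (oneSubX B) := by
  ext1 (a | a) (b | b) <;> simp [oneSubX, edgeJoin, one_apply, single_apply, apply_ite]

/-- A closed walk at `i` alternates closed walks in the first graph with excursions across the edge
and back, each weighted by $X^2 W_B$; summing gives a geometric series. -/
theorem walkMatrix_edgeJoin (A : Matrix ι ι ℝ) (B : Matrix κ κ ℝ) (i : ι) (j : κ) :
    walkMatrix (edgeJoin A B i j) (.inl i) (.inl i) =
      walkMatrix A i i * edgeFactor (walkMatrix A i i) (walkMatrix B j j) := by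
  set g := edgeFactor (walkMatrix A i i) (walkMatrix B j j) with hg
  have hx : oneSubX A *ᵥ (walkMatrix A).col i = Pi.single i 1 := by
    rw [← mulVec_single_one, mulVec_mulVec, oneSubX_mul_walkMatrix, one_mulVec]
  have hy : oneSubX B *ᵥ (walkMatrix B).col j = Pi.single j 1 := by
    rw [← mulVec_single_one, mulVec_mulVec, oneSubX_mul_walkMatrix, one_mulVec]
  -- The column of the resolvent at `i`: each block is a multiple of its own root column, and the
  -- second coefficient is what the edge carries over from `i`.
  have key : oneSubX (edgeJoin A B i j) *ᵥ
      Sum.elim (g • (walkMatrix A).col i) ((X * walkMatrix A i i * g) • (walkMatrix B).col j) =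
      Pi.single (.inl i) 1 := by
    rw [oneSubX_edgeJoin, fromBlocks_mulVec, Sum.elim_comp_inl, Sum.elim_comp_inr, mulVec_smul,
      mulVec_smul, mulVec_smul, mulVec_smul, hx, hy, single_mulVec, single_mulVec]
    have h := mul_edgeFactor (walkMatrix A i i) (walkMatrix B j j)
    rw [← hg] at h
    ext1 (a | a)
    · rcases eq_or_ne a i with rfl | ha
      · simp
        linear_combination h
      · simp [ha]
    · rcases eq_or_ne a j with rfl | ha
      · simp
        ring
      · simp [ha]
  have := congrFun (eq_walkMatrix_mulVec key) (.inl i)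
  rw [mulVec_single_one] at this
  simp only [Sum.elim_inl, Pi.smul_apply, col_apply, smul_eq_mul] at this
  rw [← this, mul_comm]

/-- The Schur complement of the first block alters `oneSubX B` only at `(j, j)`, a rank-one update
whose determinant factor is $1 - X^2 W_A W_B$. -/
theorem detSeries_edgeJoin (A : Matrix ι ι ℝ) (B : Matrix κ κ ℝ) (i : ι) (j : κ) :
    detSeries (edgeJoin A B i j) =
      detSeries A * detSeries B * edgeFactor (walkMatrix A i i) (walkMatrix B j j) := by
  let _ : Invertible (oneSubX A) :=
    ⟨walkMatrix A, walkMatrix_mul_oneSubX A, oneSubX_mul_walkMatrix A⟩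
  have hinv : ⅟(oneSubX A) = walkMatrix A := rfl
  have hS : (single j i (-X) : Matrix κ ι ℝ⟦X⟧) * walkMatrix A *
      (single i j (-X) : Matrix ι κ ℝ⟦X⟧) = single j j (X ^ 2 * walkMatrix A i i) := by
    ext1 a b
    rw [single_mul_mul_single]
    congr 1
    ring
  have hB : oneSubX B - single j j (X ^ 2 * walkMatrix A i i) =
      oneSubX B * (1 - walkMatrix B * single j j (X ^ 2 * walkMatrix A i i)) := by
    rw [Matrix.mul_sub, Matrix.mul_one, ← Matrix.mul_assoc, oneSubX_mul_walkMatrix, Matrix.one_mul]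
  have hd : (1 - walkMatrix B * single j j (X ^ 2 * walkMatrix A i i)).det =
      1 - X ^ 2 * (walkMatrix A i i * walkMatrix B j j) := by
    have : single j j (X ^ 2 * walkMatrix A i i) =
        replicateCol Unit (Pi.single j (X ^ 2 * walkMatrix A i i)) *
          (replicateRow Unit (Pi.single j 1) : Matrix Unit κ ℝ⟦X⟧) := by
      ext1 a b
      by_cases ha : a = j <;> by_cases hb : b = j <;>
        simp [mul_apply, ha, hb, eq_comm (a := j)]
    rw [this, ← Matrix.mul_assoc, det_one_sub_mul_comm]
    simp [mul_apply, Pi.single_apply]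
    ring
  have hdet : (oneSubX (edgeJoin A B i j)).det = (oneSubX A).det * (oneSubX B).det *
      (1 - X ^ 2 * (walkMatrix A i i * walkMatrix B j j)) := by
    rw [oneSubX_edgeJoin, det_fromBlocks₁₁, hinv, hS, hB, det_mul, hd, mul_assoc]
  rw [detSeries, hdet, PowerSeries.mul_inv_rev, PowerSeries.mul_inv_rev, detSeries, detSeries,
    edgeFactor]
  ring

end EdgeJoin

end Matrix

/-! ### Generating function of the complete homogeneous polynomials -/

/-- The inverse is a product of geometric series. Its coefficient sums over exponent vectors of
total `d`, which are the multiplicity functions of multisets of size `d`. -/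
theorem PowerSeries.coeff_prod_one_sub_inv {ι : Type*} [Fintype ι] [DecidableEq ι] (x : ι → ℝ)
    (d : ℕ) : coeff d (∏ i, (1 - C (x i) * X : ℝ⟦X⟧))⁻¹ = chsEval d x := by
  have hgeom (i : ι) : (1 - C (x i) * X : ℝ⟦X⟧) * mk (fun k => x i ^ k) = 1 := by
    ext (_ | n)
    · simp [sub_mul, mul_assoc]
    · simp [sub_mul, mul_assoc, coeff_one, coeff_succ_X_mul, pow_succ']
  have hinv : (∏ i, (1 - C (x i) * X : ℝ⟦X⟧))⁻¹ = ∏ i, mk (fun k => x i ^ k) := by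
    rw [eq_comm, PowerSeries.eq_inv_iff_mul_eq_one (by simp [map_prod]), ← Finset.prod_mul_distrib]
    exact Finset.prod_eq_one fun i _ => by rw [mul_comm, hgeom]
  rw [hinv, coeff_prod, chsEval, MvPolynomial.hsymm, map_sum, eq_comm]
  refine Finset.sum_bij' (fun s _ => (Sym.equivNatSum ι d s : ι →₀ ℕ))
    (fun s hs => (Sym.equivNatSum ι d).symm ⟨s, ?_⟩) ?_ ?_ ?_ ?_ ?_
  · simpa [Finsupp.sum_fintype, Finset.mem_finsuppAntidiag] using hs
  · intro s _
    rw [Finset.mem_finsuppAntidiag]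
    refine ⟨?_, Finset.subset_univ _⟩
    rw [Finset.sum_congr rfl fun a _ => Sym.coe_equivNatSum_apply_apply ι d s a,
      Multiset.sum_count_eq_card fun _ _ => Finset.mem_univ _]
    exact s.2
  · simp
  · simp
  · simp
  · intro s _
    have h : MvPolynomial.eval x (s.1.map MvPolynomial.X).prod = (s.1.map x).prod := by
      rw [← Multiset.prod_hom, Multiset.map_map]
      simp
    rw [h, Finset.prod_multiset_map_count]
    simp only [coeff_mk, Sym.coe_equivNatSum_apply_apply]
    refine Finset.prod_subset (Finset.subset_univ _) fun i _ hi => ?_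
    rw [Multiset.mem_toFinset] at hi
    rw [Multiset.count_eq_zero_of_notMem hi, pow_zero]

theorem Polynomial.reverse_X_sub_C {R : Type*} [Ring R] [Nontrivial R] (a : R) :
    (Polynomial.X - Polynomial.C a : Polynomial R).reverse =
      1 - Polynomial.C a * Polynomial.X := by
  have h : (Polynomial.X : Polynomial R).reverse = 1 := by
    rw [← one_mul Polynomial.X, Polynomial.reverse_mul_X, ← Polynomial.C_1, Polynomial.reverse_C]
  have := Polynomial.reverse_add_C (Polynomial.X : Polynomial R) (-a)
  rw [h, Polynomial.natDegree_X, pow_one] at this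
  rw [sub_eq_add_neg, ← Polynomial.C_neg, this, Polynomial.C_neg, neg_mul, sub_eq_add_neg]

theorem Polynomial.reverse_prod_of_domain {R ι : Type*} [CommRing R] [IsDomain R] (s : Finset ι)
    (f : ι → Polynomial R) : (∏ i ∈ s, f i).reverse = ∏ i ∈ s, (f i).reverse := by
  classical
  induction s using Finset.induction_on with
  | empty => simpa using Polynomial.reverse_C (1 : R)
  | insert i s hi ih => rw [Finset.prod_insert hi, Finset.prod_insert hi, reverse_mul_of_domain, ih]

/-- The numbers `h_d` of the eigenvalues are generated by `1 / det (1 - X A)`. -/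
theorem Matrix.IsHermitian.coeff_detSeries {ι : Type*} [Fintype ι] [DecidableEq ι]
    {A : Matrix ι ι ℝ} (hA : A.IsHermitian) (d : ℕ) :
    coeff d A.detSeries = chsEval d hA.eigenvalues := by
  have hrev : A.charpolyRev =
      ∏ i, (1 - Polynomial.C (hA.eigenvalues i) * Polynomial.X) := by
    rw [← reverse_charpoly, hA.charpoly_eq, Polynomial.reverse_prod_of_domain]
    simp [Polynomial.reverse_X_sub_C]
  have hdet : (oneSubX A).det = ((A.charpolyRev : Polynomial ℝ) : ℝ⟦X⟧) := by
    rw [charpolyRev, ← Polynomial.coeToPowerSeries.ringHom_apply, RingHom.map_det]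
    congr 1
    ext1 i j
    simp [oneSubX, one_apply, apply_ite, mul_comm (X : ℝ⟦X⟧)]
  rw [← coeff_prod_one_sub_inv, detSeries, hdet, hrev,
    ← Polynomial.coeToPowerSeries.ringHom_apply, map_prod]
  simp

/-! ### Splitting a tree at an edge -/

theorem SimpleGraph.connected_induce_reachable {V : Type*} (G : SimpleGraph V) (v : V) :
    (G.induce {x | G.Reachable v x}).Connected := by
  have h : {x | G.Reachable v x} = (G.connectedComponentMk v).supp := by
    ext x
    simp [SimpleGraph.reachable_comm]
  rw [h]
  exact (G.connectedComponentMk v).connected_toSimpleGraph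

/-- Any edge `uw` at `u` is a bridge; `S` is the component of `u` once it is deleted. -/
theorem SimpleGraph.IsTree.exists_edge_split {V : Type*} [Nontrivial V] {T : SimpleGraph V}
    (hT : T.IsTree) (u : V) : ∃ (S : Set V) (w : V), u ∈ S ∧ w ∉ S ∧ (T.induce S).IsTree ∧
      (T.induce Sᶜ).IsTree ∧ ∀ x ∈ S, ∀ y ∉ S, (T.Adj x y ↔ x = u ∧ y = w) := by
  obtain ⟨w, huw⟩ := hT.connected.preconnected.exists_adj_of_nontrivial u
  set H := T.deleteEdges {s(u, w)} with hH
  have hbridge : ¬ H.Reachable u w :=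
    SimpleGraph.isAcyclic_iff_forall_isBridge.1 hT.isAcyclic (T.mem_edgeSet.2 huw)
  have hadj {x y : V} (h : T.Adj x y) : H.Adj x y ∨ (x = u ∧ y = w) ∨ (x = w ∧ y = u) := by
    by_cases he : s(x, y) = s(u, w)
    · exact .inr (by simpa using he)
    · left
      rw [hH, SimpleGraph.deleteEdges_adj]
      exact ⟨h, he⟩
  -- Follow a walk from `y` to `u`: until it first uses the edge `uw`, it stays in `H`.
  have hdich (y : V) : H.Reachable u y ∨ H.Reachable w y := by
    have := hT.connected.preconnected y u
    obtain ⟨p⟩ := this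
    clear_value H
    induction p with
    | nil => exact .inl .rfl
    | cons h p ih =>
      rcases hadj h with h | ⟨rfl, -⟩ | ⟨rfl, -⟩
      · exact (ih huw hH hbridge @hadj).imp (·.trans h.symm.reachable) (·.trans h.symm.reachable)
      · exact .inl .rfl
      · exact .inr .rfl
  have htree (v : V) : (T.induce {x | H.Reachable v x}).IsTree :=
    ⟨(H.connected_induce_reachable v).mono
      (SimpleGraph.comap_monotone _ (T.deleteEdges_le _)), hT.isAcyclic.induce _⟩
  have hcompl : {x | H.Reachable u x}ᶜ = {x | H.Reachable w x} := by
    ext y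
    exact ⟨(hdich y).resolve_left, fun h h' => hbridge (h'.trans h.symm)⟩
  refine ⟨{x | H.Reachable u x}, w, .rfl, hbridge, htree u, hcompl ▸ htree w,
    fun x hx y hy => ⟨fun h => ?_, ?_⟩⟩
  · rcases hadj h with h | h | ⟨rfl, rfl⟩
    · exact absurd (hx.trans h.reachable) hy
    · exact h
    · exact absurd hx hbridge
  · rintro ⟨rfl, rfl⟩
    exact huw

/-! ### Series of stars -/

namespace PowerSeries

/-- The generating series of the numbers `h_d` of the star with `m` leaves. -/
noncomputable def starSeries (m : ℕ) : ℝ⟦X⟧ := (1 - (m : ℝ⟦X⟧) * X ^ 2)⁻¹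

theorem mul_starSeries (m : ℕ) : (1 - (m : ℝ⟦X⟧) * X ^ 2) * starSeries m = 1 :=
  CoeffLE.one_sub_mul_inv (by simp)

theorem natCast_nonneg (m : ℕ) : CoeffLE 0 (m : ℝ⟦X⟧) := by
  simpa using CoeffLE.C_nonneg (Nat.cast_nonneg (α := ℝ) m)

theorem starSeries_nonneg (m : ℕ) : CoeffLE 0 (starSeries m) :=
  CoeffLE.one_sub_inv_nonneg ((natCast_nonneg m).mul_nonneg CoeffLE.X_sq_nonneg) (by simp)

theorem starSeries_zero : starSeries 0 = 1 := by simp [starSeries]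

/-- Attaches a leaf at the center. Removing the center of a star leaves isolated vertices, so its
walk series there equals its determinant series. -/
theorem starSeries_succ (m : ℕ) :
    starSeries (m + 1) = starSeries m * edgeFactor (starSeries m) 1 := by
  have h := mul_starSeries (m + 1)
  push_cast at h
  linear_combination starSeries m * edgeFactor (starSeries m) 1 * h -
    starSeries (m + 1) * edgeFactor (starSeries m) 1 * mul_starSeries m -
    starSeries (m + 1) * mul_edgeFactor (starSeries m) 1

/-- The double star has denominator $(1-aX^2)(1-bX^2) - X^2 = 1 - (a+b+1)X^2 + abX^4$; the extra
$abX^4$ makes its series smaller. -/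
theorem starSeries_add (a b : ℕ) :
    CoeffLE (starSeries a * starSeries b * edgeFactor (starSeries a) (starSeries b))
      (starSeries (a + b + 1)) := by
  rw [← CoeffLE.sub_nonneg_iff]
  set g := edgeFactor (starSeries a) (starSeries b) with hg
  have hgg := mul_edgeFactor (starSeries a) (starSeries b)
  rw [← hg] at hgg
  have hL : ((1 - (a : ℝ⟦X⟧) * X ^ 2) * (1 - (b : ℝ⟦X⟧) * X ^ 2) - X ^ 2) *
      (starSeries a * starSeries b * g) = 1 := by
    linear_combination (1 - (b : ℝ⟦X⟧) * X ^ 2) * starSeries b * g * mul_starSeries a +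
      g * mul_starSeries b + hgg
  have hS := mul_starSeries (a + b + 1)
  push_cast at hS
  have key : starSeries (a + b + 1) - starSeries a * starSeries b * g =
      ((a : ℝ⟦X⟧) * (b : ℝ⟦X⟧) * (X ^ 2 * X ^ 2)) *
        ((starSeries a * starSeries b * g) * starSeries (a + b + 1)) := by
    linear_combination starSeries a * starSeries b * g * hS - starSeries (a + b + 1) * hL
  rw [key]
  have ha := starSeries_nonneg a
  have hb := starSeries_nonneg b
  exact (((natCast_nonneg a).mul_nonneg (natCast_nonneg b)).mul_nonneg
    (CoeffLE.X_sq_nonneg.mul_nonneg CoeffLE.X_sq_nonneg)).mul_nonneg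
    (((ha.mul_nonneg hb).mul_nonneg (edgeFactor_nonneg ha hb)).mul_nonneg (starSeries_nonneg _))

end PowerSeries

namespace Matrix

variable {ι : Type*} [Fintype ι] [DecidableEq ι]

omit [Fintype ι] in
theorem oneSubX_zero : oneSubX (0 : Matrix ι ι ℝ) = 1 := by
  simp [oneSubX]

theorem detSeries_zero : detSeries (0 : Matrix ι ι ℝ) = 1 := by
  simp [detSeries, oneSubX_zero]

theorem walkMatrix_zero : walkMatrix (0 : Matrix ι ι ℝ) = 1 := by
  simpa [oneSubX_zero] using oneSubX_mul_walkMatrix (0 : Matrix ι ι ℝ)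

end Matrix

open Matrix

/-! ### Series of concrete graphs, and the extremal bounds -/

namespace SimpleGraph

theorem chsNorm_eq_coeff_detSeries {V : Type*} [Fintype V] [DecidableEq V] (G : SimpleGraph V)
    [DecidableRel G.Adj] (d : ℕ) :
    G.chsNorm d = coeff d (detSeries (G.adjMatrix ℝ)) ^ (1 / (d : ℝ)) := by
  obtain rfl : ‹DecidableEq V› = fun a b => Classical.propDecidable (a = b) :=
    Subsingleton.elim _ _
  obtain rfl : ‹DecidableRel G.Adj› = fun a b => Classical.propDecidable (G.Adj a b) :=
    Subsingleton.elim _ _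
  classical
  rw [SimpleGraph.chsNorm, Matrix.IsHermitian.chsNorm, ← Matrix.IsHermitian.coeff_detSeries]

theorem chsNorm_le_chsNorm {V W : Type*} [Fintype V] [DecidableEq V] [Fintype W] [DecidableEq W]
    {G : SimpleGraph V} {H : SimpleGraph W} [DecidableRel G.Adj] [DecidableRel H.Adj]
    (h₀ : CoeffLE 0 (detSeries (G.adjMatrix ℝ)))
    (h : CoeffLE (detSeries (G.adjMatrix ℝ)) (detSeries (H.adjMatrix ℝ))) (d : ℕ) :
    G.chsNorm d ≤ H.chsNorm d := by
  rw [chsNorm_eq_coeff_detSeries, chsNorm_eq_coeff_detSeries]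
  exact Real.rpow_le_rpow (by simpa using h₀ d) (h d) (by positivity)

section Families

theorem pathOfOrder_adj {n : ℕ} {i j : Fin n} :
    (pathOfOrder n).Adj i j ↔ (i : ℕ) + 1 = j ∨ (j : ℕ) + 1 = i :=
  pathGraph_adj

theorem starOfOrder_adj {n : ℕ} {i j : Fin n} :
    (starOfOrder n).Adj i j ↔ i ≠ j ∧ ((i : ℕ) = 0 ∨ (j : ℕ) = 0) :=
  Iff.rfl

instance (n : ℕ) : DecidableRel (pathOfOrder n).Adj :=
  fun _ _ => decidable_of_iff _ pathOfOrder_adj.symm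

instance (n : ℕ) : DecidableRel (starOfOrder n).Adj :=
  fun _ _ => decidable_of_iff _ starOfOrder_adj.symm

/-- The new vertex becomes `0` and the old ones shift up, so the root stays at an end. -/
theorem adjMatrix_path_eq_edgeJoin (n : ℕ) :
    ((pathOfOrder (n + 2)).adjMatrix ℝ).submatrix
        ((Equiv.sumComm _ _).trans
          ((Equiv.optionEquivSumPUnit (Fin (n + 1))).symm.trans (finSuccEquiv (n + 1)).symm))
        ((Equiv.sumComm _ _).trans
          ((Equiv.optionEquivSumPUnit (Fin (n + 1))).symm.trans (finSuccEquiv (n + 1)).symm)) =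
      edgeJoin 0 ((pathOfOrder (n + 1)).adjMatrix ℝ) () 0 := by
  ext1 (i | i) (j | j)
  · simp [edgeJoin]
  · simp [edgeJoin, adjMatrix_apply, pathOfOrder_adj, single_apply,
      eq_comm (a := (0 : Fin (n + 1))) (b := j)]
  · simp [edgeJoin, adjMatrix_apply, pathOfOrder_adj, single_apply,
      eq_comm (a := (0 : Fin (n + 1))) (b := i)]
  · simp [edgeJoin, adjMatrix_apply, pathOfOrder_adj]

theorem series_path (n : ℕ) :
    walkMatrix ((pathOfOrder (n + 1)).adjMatrix ℝ) 0 0 = pathWalk (n + 1) ∧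
      detSeries ((pathOfOrder (n + 1)).adjMatrix ℝ) = pathSeries (n + 1) := by
  induction n with
  | zero =>
    have h : (pathOfOrder (0 + 1)).adjMatrix ℝ = 0 := by
      ext1 i j
      obtain rfl := Subsingleton.elim (α := Fin 1) i j
      simp
    simp only [h, detSeries_zero, walkMatrix_zero]
    simp [pathWalk, pathSeries, edgeFactor]
  | succ n ih =>
    obtain ⟨hW, hF⟩ := ih
    have h := adjMatrix_path_eq_edgeJoin n
    have h₁ := walkMatrix_edgeJoin 0 ((pathOfOrder (n + 1)).adjMatrix ℝ) () 0
    have h₂ := detSeries_edgeJoin 0 ((pathOfOrder (n + 1)).adjMatrix ℝ) () 0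
    rw [← h, walkMatrix_submatrix_equiv, hW, walkMatrix_zero, one_apply_eq, one_mul] at h₁
    rw [← h, detSeries_submatrix_equiv, hW, hF, detSeries_zero, walkMatrix_zero, one_apply_eq,
      one_mul] at h₂
    exact ⟨h₁, h₂⟩

/-- The new leaf is placed last, so the center keeps the label `0`. -/
theorem adjMatrix_star_eq_edgeJoin (n : ℕ) :
    ((starOfOrder (n + 2)).adjMatrix ℝ).submatrix
        ((Equiv.optionEquivSumPUnit (Fin (n + 1))).symm.trans finSuccEquivLast.symm)
        ((Equiv.optionEquivSumPUnit (Fin (n + 1))).symm.trans finSuccEquivLast.symm) =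
      edgeJoin ((starOfOrder (n + 1)).adjMatrix ℝ) 0 0 () := by
  ext1 (i | i) (j | j)
  · simp [edgeJoin, adjMatrix_apply, starOfOrder_adj]
  · simp [edgeJoin, adjMatrix_apply, starOfOrder_adj, single_apply,
      eq_comm (a := (0 : Fin (n + 1))) (b := i)]
  · simp [edgeJoin, adjMatrix_apply, starOfOrder_adj, single_apply,
      (Fin.castSucc_lt_last j).ne', eq_comm (a := (0 : Fin (n + 1))) (b := j)]
  · simp [edgeJoin]

theorem series_star (n : ℕ) :
    walkMatrix ((starOfOrder (n + 1)).adjMatrix ℝ) 0 0 = starSeries n ∧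
      detSeries ((starOfOrder (n + 1)).adjMatrix ℝ) = starSeries n := by
  induction n with
  | zero =>
    have h : (starOfOrder (0 + 1)).adjMatrix ℝ = 0 := by
      ext1 i j
      obtain rfl := Subsingleton.elim (α := Fin 1) i j
      simp
    simp [h, detSeries_zero, walkMatrix_zero, starSeries_zero]
  | succ n ih =>
    obtain ⟨hW, hF⟩ := ih
    have h := adjMatrix_star_eq_edgeJoin n
    have h₁ := walkMatrix_edgeJoin ((starOfOrder (n + 1)).adjMatrix ℝ) 0 0 ()
    have h₂ := detSeries_edgeJoin ((starOfOrder (n + 1)).adjMatrix ℝ) 0 0 ()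
    rw [← h, walkMatrix_submatrix_equiv, hW, walkMatrix_zero, one_apply_eq,
      ← starSeries_succ] at h₁
    rw [← h, detSeries_submatrix_equiv, hW, hF, detSeries_zero, walkMatrix_zero, one_apply_eq,
      mul_one, ← starSeries_succ] at h₂
    exact ⟨h₁, h₂⟩

end Families

/-- The bounds need each other: `edgeFactor` depends on the walk series, bounded below by the path
and above, through the determinant series, by the star. Every root is allowed because the far end of
the cut edge is not under control. -/
theorem IsTree.series_bounds {n : ℕ} {V : Type*} [Fintype V] [DecidableEq V] {T : SimpleGraph V}
    [DecidableRel T.Adj] (hT : T.IsTree) (hn : Fintype.card V = n + 1) (u : V) :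
    CoeffLE (pathWalk (n + 1)) (walkMatrix (T.adjMatrix ℝ) u u) ∧
      CoeffLE (walkMatrix (T.adjMatrix ℝ) u u) (detSeries (T.adjMatrix ℝ)) ∧
      CoeffLE (pathSeries (n + 1)) (detSeries (T.adjMatrix ℝ)) ∧
      CoeffLE (detSeries (T.adjMatrix ℝ)) (starSeries n) := by
  classical
  induction n using Nat.strong_induction_on generalizing V with
  | _ n ih =>
  rcases Nat.eq_zero_or_pos n with rfl | hpos
  · have : Subsingleton V := Fintype.card_le_one_iff_subsingleton.1 hn.le
    have h : T.adjMatrix ℝ = 0 := by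
      ext1 i j
      obtain rfl := Subsingleton.elim i j
      simp
    simp [h, detSeries_zero, walkMatrix_zero, pathWalk, pathSeries, edgeFactor, starSeries_zero,
      CoeffLE.refl]
  have : Nontrivial V := Fintype.one_lt_card_iff_nontrivial.1 (by omega)
  obtain ⟨S, w, hu, hw, hS, hSc, hadj⟩ := hT.exists_edge_split u
  have hcard : Fintype.card S + Fintype.card (Sᶜ : Set V) = n + 1 := by
    rw [← hn, ← Fintype.card_sum, Fintype.card_congr (Equiv.Set.sumCompl S)]
  have hposS : 0 < Fintype.card S := Fintype.card_pos_iff.2 ⟨⟨u, hu⟩⟩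
  have hposSc : 0 < Fintype.card (Sᶜ : Set V) := Fintype.card_pos_iff.2 ⟨⟨w, hw⟩⟩
  obtain ⟨a, ha⟩ := Nat.exists_eq_add_one.2 hposS
  obtain ⟨b, hb⟩ := Nat.exists_eq_add_one.2 hposSc
  obtain rfl : n = a + b + 1 := by omega
  have hjoin : (T.adjMatrix ℝ).submatrix (Equiv.Set.sumCompl S) (Equiv.Set.sumCompl S) =
      edgeJoin ((T.induce S).adjMatrix ℝ) ((T.induce Sᶜ).adjMatrix ℝ) ⟨u, hu⟩ ⟨w, hw⟩ := by
    ext1 (⟨x, hx⟩ | ⟨x, hx⟩) (⟨y, hy⟩ | ⟨y, hy⟩)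
    · simp [edgeJoin, adjMatrix_apply]
    · simp [edgeJoin, adjMatrix_apply, single_apply, hadj x hx y hy, eq_comm]
    · simp [edgeJoin, adjMatrix_apply, single_apply, T.adj_comm x y, hadj y hy x hx, eq_comm,
        and_comm]
    · simp [edgeJoin, adjMatrix_apply]
  have hW := walkMatrix_edgeJoin ((T.induce S).adjMatrix ℝ) ((T.induce Sᶜ).adjMatrix ℝ)
    ⟨u, hu⟩ ⟨w, hw⟩
  have hF := detSeries_edgeJoin ((T.induce S).adjMatrix ℝ) ((T.induce Sᶜ).adjMatrix ℝ)
    ⟨u, hu⟩ ⟨w, hw⟩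
  rw [← hjoin, walkMatrix_submatrix_equiv, Equiv.Set.sumCompl_apply_inl] at hW
  rw [← hjoin, detSeries_submatrix_equiv] at hF
  obtain ⟨pW₁, WF₁, pF₁, Fs₁⟩ := ih a (by omega) hS ha ⟨u, hu⟩
  obtain ⟨pW₂, WF₂, pF₂, Fs₂⟩ := ih b (by omega) hSc hb ⟨w, hw⟩
  rw [hW, hF]
  set W₁ := walkMatrix ((T.induce S).adjMatrix ℝ) ⟨u, hu⟩ ⟨u, hu⟩
  set W₂ := walkMatrix ((T.induce Sᶜ).adjMatrix ℝ) ⟨w, hw⟩ ⟨w, hw⟩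
  set F₁ := detSeries ((T.induce S).adjMatrix ℝ)
  set F₂ := detSeries ((T.induce Sᶜ).adjMatrix ℝ)
  have p₁ := pathWalk_nonneg (a + 1)
  have p₂ := pathWalk_nonneg (b + 1)
  have q₁ := pathSeries_nonneg (a + 1)
  have q₂ := pathSeries_nonneg (b + 1)
  have W₁0 := p₁.trans pW₁
  have W₂0 := p₂.trans pW₂
  have F₁0 := q₁.trans pF₁
  have F₂0 := q₂.trans pF₂
  have g0 := edgeFactor_nonneg W₁0 W₂0
  have gp := edgeFactor_mono p₁ pW₁ p₂ pW₂
  have gs := edgeFactor_mono W₁0 (WF₁.trans Fs₁) W₂0 (WF₂.trans Fs₂)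
  have e : a + b + 1 + 1 = (a + 1) + (b + 1) := by omega
  have one0 : CoeffLE 0 1 := by simpa using CoeffLE.C_nonneg zero_le_one
  refine ⟨?_, ?_, ?_, ?_⟩
  -- Induction compares with a path rooted at an inner vertex; `pathWalk_add_le` moves the root to
  -- an end.
  · rw [e]
    exact (pathWalk_add_le a (b + 1)).trans (p₁.mul_mono pW₁ (edgeFactor_nonneg p₁ p₂) gp)
  -- The edge factor is common, and `F₂` dominates `1` since its constant term is `1`.
  · refine CoeffLE.mul_mono W₁0 ?_ g0 (.refl _)
    have := W₁0.mul_mono WF₁ one0 (F₂0.one_le (constantCoeff_detSeries _))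
    rwa [mul_one] at this
  · rw [e, pathSeries_add]
    exact (q₁.mul_nonneg q₂).mul_mono (q₁.mul_mono pF₁ q₂ pF₂) (edgeFactor_nonneg p₁ p₂) gp
  -- Replacing both halves by stars rooted at their centers gives a double star.
  · exact ((F₁0.mul_nonneg F₂0).mul_mono (F₁0.mul_mono Fs₁ F₂0 Fs₂) g0 gs).trans
      (starSeries_add a b)

theorem detSeries_adjMatrix_mono {V : Type*} [Fintype V] [DecidableEq V] {G H : SimpleGraph V}
    [DecidableRel G.Adj] [DecidableRel H.Adj] (h : G ≤ H) :
    CoeffLE (detSeries (G.adjMatrix ℝ)) (detSeries (H.adjMatrix ℝ)) := by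
  refine detSeries_mono (fun i j => ?_) fun i j => ?_
  · rw [adjMatrix_apply]
    split_ifs <;> norm_num
  · rw [adjMatrix_apply, adjMatrix_apply]
    by_cases hG : G.Adj i j
    · simp [hG, h hG]
    · rw [if_neg hG]
      split_ifs <;> norm_num

theorem detSeries_adjMatrix_le_complete {V : Type*} [Fintype V] [DecidableEq V]
    (G : SimpleGraph V) [DecidableRel G.Adj] {n : ℕ} [DecidableRel (completeOfOrder n).Adj]
    (hn : Fintype.card V = n) :
    CoeffLE (detSeries (G.adjMatrix ℝ)) (detSeries ((completeOfOrder n).adjMatrix ℝ)) := by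
  classical
  have e := Fintype.equivFinOfCardEq hn
  have h : (completeGraph V).adjMatrix ℝ =
      ((completeOfOrder n).adjMatrix ℝ).submatrix e e := by
    ext1 i j
    rw [submatrix_apply, adjMatrix_apply, adjMatrix_apply]
    exact if_congr (by simp [completeOfOrder]) rfl rfl
  rw [← detSeries_submatrix_equiv e, ← h]
  exact detSeries_adjMatrix_mono le_top

theorem IsTree.chsNorm_bounds {V : Type*} [Fintype V] {T : SimpleGraph V} (hT : T.IsTree) {n : ℕ}
    (hn : Fintype.card V = n) (d : ℕ) :
    (pathOfOrder n).chsNorm d ≤ T.chsNorm d ∧ T.chsNorm d ≤ (starOfOrder n).chsNorm d := by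
  classical
  obtain ⟨u⟩ := hT.connected.nonempty
  obtain ⟨m, rfl⟩ : ∃ m, n = m + 1 :=
    Nat.exists_eq_add_one.2 (hn ▸ Fintype.card_pos_iff.2 ⟨u⟩)
  obtain ⟨-, -, hp, hs⟩ := hT.series_bounds hn u
  have h0 := pathSeries_nonneg (m + 1)
  exact ⟨chsNorm_le_chsNorm (by rwa [(series_path m).2]) (by rwa [(series_path m).2]) d,
    chsNorm_le_chsNorm (h0.trans hp) (by rwa [(series_star m).2]) d⟩

theorem Connected.chsNorm_bounds {V : Type*} [Fintype V] {G : SimpleGraph V} (hG : G.Connected)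
    {n : ℕ} (hn : Fintype.card V = n) (d : ℕ) :
    (pathOfOrder n).chsNorm d ≤ G.chsNorm d ∧ G.chsNorm d ≤ (completeOfOrder n).chsNorm d := by
  classical
  obtain ⟨T, hTG, hT⟩ := hG.exists_isTree_le
  obtain ⟨u⟩ := hG.nonempty
  obtain ⟨m, rfl⟩ : ∃ m, n = m + 1 :=
    Nat.exists_eq_add_one.2 (hn ▸ Fintype.card_pos_iff.2 ⟨u⟩)
  have hT0 := (pathSeries_nonneg (m + 1)).trans (hT.series_bounds hn u).2.2.1
  have hTG' := detSeries_adjMatrix_mono hTG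
  exact ⟨(hT.chsNorm_bounds hn d).1.trans (chsNorm_le_chsNorm hT0 hTG' d),
    chsNorm_le_chsNorm (hT0.trans hTG') (G.detSeries_adjMatrix_le_complete hn) d⟩

end SimpleGraph

end GeneratingSeries

theorem theorem2 (d : ℕ) (hd : Even d) (hd2 : 2 ≤ d) (n : ℕ) :
    (∀ {V : Type*} [Fintype V] (G : SimpleGraph V), Fintype.card V = n → G.Connected →
      (pathOfOrder n).chsNorm d ≤ G.chsNorm d ∧
        G.chsNorm d ≤ (completeOfOrder n).chsNorm d) ∧
    (∀ {V : Type*} [Fintype V] (T : SimpleGraph V), Fintype.card V = n → T.IsTree →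
      (pathOfOrder n).chsNorm d ≤ T.chsNorm d ∧
        T.chsNorm d ≤ (starOfOrder n).chsNorm d) := by
  exact ⟨fun G hn hG => hG.chsNorm_bounds hn d, fun T hn hT => hT.chsNorm_bounds hn d⟩
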